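/- Let $n\ge 1$, let $(K,k_0)$ be an Eilenberg–MacLane space $K(\mathbb Z,n)$ (a path-connected pointed space of the homotopy type of a CW complex with $\pi_n\cong\mathbb Z$ and all other homotopy groups trivial), and let $\iota\in H^n(K;\mathbb Z)$ be a fundamental class, i.e. a generator of $H^n(K;\mathbb Z)\cong\mathbb Z$; $H^n$ is singular cohomology. Let $(X,x_0)$, $(Y,y_0)$ be pointed topological spaces and let $j: Y\vee K\hookrightarrow Y\times K$ be the inclusion. For a map $f:X\to Y$ the $n$-th generalized dual Gottlieb set is $$G^n(X,f,Y)=\{\alpha\in H^n(X;\mathbb Z) \mid \exists\, a:X\to K \text{ with } a^*\iota=\alpha,\ \exists\, \phi:X\to Y\vee K \text{ with } j\circ\phi\sim (f\times a)\circ\Delta\},$$ where $\Delta: X\to X\times X$ is the diagonal. On the homotopy set $[X,Y]$ write $[f]\leqq_L[g]$ if $[f]=[t]\circ[g]$ for some $[t]\in[Y,Y]$, write $[f]\sim_L[g]$ if $[f]\leqq_L[g]$ and $[g]\leqq_L[f]$, and put $[X,Y]_L=[X,Y]/\sim_L$ with projection $\pi_L:[X,Y]\to[X,Y]_L$. Then: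 1. if $g\sim s\circ f$ for some $s:Y\to Y$, then $G^n(X,f,Y)\subset G^n(X,g,Y)$; 2. if $[f]\sim_L[g]$, then $G^n(X,f,Y)=G^n(X,g,Y)$; 3. consequently $\mathfrak g^n:[X,Y]\to\mathcal S(H^n(X;\mathbb Z))$, $[f]\mapsto G^n(X,f,Y)$, and $\mathfrak g^n_L:[X,Y]_L\to\mathcal S(H^n(X;\mathbb Z))$, $[f]_L\mapsto G^n(X,f,Y)$, are well-defined maps into the set of subsets of $H^n(X;\mathbb Z)$, and $\mathfrak g^n_L\circ\pi_L=\mathfrak g^n$. These statements hold (a) for arbitrary pointed spaces $X$, $Y$ when all maps and homotopies (including those defining $[X,Y]$, $[Y,Y]$ and $G^n$) preserve base points, and (b) when all maps and homotopies are free, provided that $Y$ is path-connected and well-pointed (the inclusion $\{y_0\}\to Y$ has the homotopy extension property; for instance, $Y$ a connected CW complex). -/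

import Mathlib

open scoped Topology ContinuousMap

noncomputable section

namespace DualGottlieb

universe u v w

/-! ### Singular cohomology with integer coefficients -/

section Cohomology

variable {X : Type u} [TopologicalSpace X] {Z : Type v} [TopologicalSpace Z]

/-- Singular `n`-simplices of `X`. -/
abbrev SingularSimplex (n : ℕ) (X : Type u) [TopologicalSpace X] : Type u :=
  C(stdSimplex ℝ (Fin (n + 1)), X)

/-- The `i`-th face of a singular simplex: precomposition with the affine map of standard
simplices that skips the `i`-th vertex. -/
def SingularSimplex.face {n : ℕ} (σ : SingularSimplex (n + 1) X) (i : Fin (n + 2)) :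
    SingularSimplex n X :=
  σ.comp ⟨stdSimplex.map (Fin.succAbove i), stdSimplex.continuous_map _⟩

/-- Integral singular cochains. -/
abbrev Cochain (n : ℕ) (X : Type u) [TopologicalSpace X] : Type u :=
  SingularSimplex n X → ℤ

/-- The coboundary `(δ c)(σ) = ∑ i, (-1) ^ i * c (i-th face of σ)`. -/
def coboundary (n : ℕ) (X : Type u) [TopologicalSpace X] : Cochain n X →+ Cochain (n + 1) X where
  toFun c σ := ∑ i : Fin (n + 2), (-1) ^ (i : ℕ) * c (σ.face i)
  map_zero' := by
    funext σ
    simp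
  map_add' c d := by
    funext σ
    simp [mul_add, Finset.sum_add_distrib]

/-- The group of `n`-cocycles. -/
def cocycles (n : ℕ) (X : Type u) [TopologicalSpace X] : AddSubgroup (Cochain n X) :=
  (coboundary n X).ker

/-- The group of `n`-coboundaries. -/
def coboundaries : (n : ℕ) → (X : Type u) → [TopologicalSpace X] → AddSubgroup (Cochain n X)
  | 0, _, _ => ⊥
  | n + 1, X, _ => (coboundary n X).range

/-- The singular cohomology group `H^n(X; ℤ)`: cocycles modulo coboundaries. -/
abbrev Cohomology (n : ℕ) (X : Type u) [TopologicalSpace X] : Type u :=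
  cocycles n X ⧸ (coboundaries n X).addSubgroupOf (cocycles n X)

/-- Pull-back of cochains along a continuous map. -/
def Cochain.pullback (n : ℕ) (h : C(X, Z)) : Cochain n Z →+ Cochain n X where
  toFun c σ := c (h.comp σ)
  map_zero' := rfl
  map_add' _ _ := rfl

theorem coboundary_pullback (n : ℕ) (h : C(X, Z)) (c : Cochain n Z) :
    coboundary n X (Cochain.pullback n h c) = Cochain.pullback (n + 1) h (coboundary n Z c) :=
  rfl

theorem pullback_mem_cocycles (n : ℕ) (h : C(X, Z)) {c : Cochain n Z} (hc : c ∈ cocycles n Z) :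
    Cochain.pullback n h c ∈ cocycles n X := by
  have hc' : coboundary n Z c = 0 := hc
  change coboundary n X (Cochain.pullback n h c) = 0
  rw [coboundary_pullback, hc', map_zero]

theorem pullback_mem_coboundaries (n : ℕ) (h : C(X, Z)) {c : Cochain n Z}
    (hc : c ∈ coboundaries n Z) : Cochain.pullback n h c ∈ coboundaries n X := by
  cases n with
  | zero =>
    have hc' : c = 0 := hc
    rw [hc', map_zero]
    exact AddSubgroup.zero_mem _
  | succ n =>
    obtain ⟨b, rfl⟩ := hc
    exact ⟨Cochain.pullback n h b, coboundary_pullback n h b⟩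

/-- Pull-back of cocycles along a continuous map. -/
def cocyclesPullback (n : ℕ) (h : C(X, Z)) : cocycles n Z →+ cocycles n X :=
  ((Cochain.pullback n h).comp (cocycles n Z).subtype).codRestrict (cocycles n X)
    fun c => pullback_mem_cocycles n h c.2

/-- The induced homomorphism `h^* : H^n(Z; ℤ) → H^n(X; ℤ)`. -/
def Cohomology.pullback (n : ℕ) (h : C(X, Z)) : Cohomology n Z →+ Cohomology n X :=
  QuotientAddGroup.map _ _ (cocyclesPullback n h) fun _ hc => pullback_mem_coboundaries n h hc

end Cohomology

/-! ### Eilenberg–MacLane spaces `K(ℤ, n)`, `n ≥ 1` -/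

/-- `X` has the homotopy type of a CW complex. -/
def HasCWHomotopyType (X : Type u) [TopologicalSpace X] : Prop :=
  ∃ (W : Type u) (_ : TopologicalSpace W), T2Space W ∧
    Nonempty (Topology.CWComplex (Set.univ : Set W)) ∧ Nonempty (X ≃ₕ W)

/-- `(K, k₀)` is an Eilenberg–MacLane space `K(ℤ, n)`. -/
structure IsEilenbergMacLane (n : ℕ) [NeZero n] (K : Type u) [TopologicalSpace K] (k₀ : K) :
    Prop where
  pathConnected : PathConnectedSpace K
  homotopyGroup_self : Nonempty (HomotopyGroup.Pi n K k₀ ≃* Multiplicative ℤ)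
  homotopyGroup_other : ∀ i : ℕ, i ≠ n → Subsingleton (HomotopyGroup.Pi i K k₀)
  hasCWHomotopyType : HasCWHomotopyType K

/-- `ι` is a fundamental class of `K = K(ℤ, n)`: a generator of the (infinite cyclic) group
`H^n(K; ℤ)`.  Generators correspond to the identifications `π_n(K) ≅ ℤ`. -/
def IsFundamentalClass {n : ℕ} {K : Type u} [TopologicalSpace K] (ι : Cohomology n K) : Prop :=
  ∀ α : Cohomology n K, ∃ m : ℤ, α = m • ι

/-! ### Wedges and base points -/

section Wedge

variable {Y : Type u} [TopologicalSpace Y] {K : Type v} [TopologicalSpace K]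

/-- The wedge `Y ∨ K` of two pointed spaces, as the subspace `Y × {k₀} ∪ {y₀} × K` of `Y × K`. -/
abbrev Wedge (y₀ : Y) (k₀ : K) : Type (max u v) :=
  {p : Y × K // p.1 = y₀ ∨ p.2 = k₀}

/-- The base point of the wedge. -/
def Wedge.base (y₀ : Y) (k₀ : K) : Wedge y₀ k₀ := ⟨(y₀, k₀), Or.inl rfl⟩

/-- The inclusion `Y ∨ K → Y × K`. -/
def Wedge.incl (y₀ : Y) (k₀ : K) : C(Wedge y₀ k₀, Y × K) := ⟨Subtype.val, continuous_subtype_val⟩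

/-- `(Y, y₀)` is well-pointed: the inclusion of the base point has the homotopy extension
property. -/
def WellPointed (y₀ : Y) : Prop :=
  ∀ (Z : Type u) [TopologicalSpace Z] (f : C(Y, Z)) (γ : C(unitInterval, Z)), γ 0 = f y₀ →
    ∃ H : C(unitInterval × Y, Z), (∀ y, H (0, y) = f y) ∧ ∀ t, H (t, y₀) = γ t

end Wedge

/-! ### The free homotopy set and free dual Gottlieb sets -/

section Free

variable {X : Type u} [TopologicalSpace X] {Y : Type v} [TopologicalSpace Y]

/-- The homotopy set `[X, Y]`. -/
def HomotopySet (X : Type u) [TopologicalSpace X] (Y : Type v) [TopologicalSpace Y] :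
    Type (max u v) :=
  Quotient (⟨ContinuousMap.Homotopic, ContinuousMap.Homotopic.equivalence⟩ : Setoid C(X, Y))

/-- The homotopy class `[f]`. -/
def HomotopySet.mk (f : C(X, Y)) : HomotopySet X Y := Quotient.mk _ f

/-- The action `[t] ∘ [f] = [t ∘ f]` of `[Y, Y]` on `[X, Y]`. -/
def HomotopySet.comp (t : HomotopySet Y Y) (a : HomotopySet X Y) : HomotopySet X Y :=
  Quotient.map₂ (fun (t : C(Y, Y)) (f : C(X, Y)) => t.comp f)
    (fun _ _ ht _ _ hf => ContinuousMap.Homotopic.comp ht hf) t a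

/-- The relation `a ≦_L b`: there is `t ∈ [Y, Y]` with `a = t ∘ b`. -/
def HomotopySet.leL (a b : HomotopySet X Y) : Prop :=
  ∃ t : HomotopySet Y Y, a = t.comp b

instance : IsPreorder (HomotopySet X Y) HomotopySet.leL where
  refl a := by
    refine ⟨HomotopySet.mk (ContinuousMap.id Y), ?_⟩
    induction a using Quotient.inductionOn
    rfl
  trans a b c := by
    rintro ⟨t, rfl⟩ ⟨t', rfl⟩
    refine ⟨t.comp t', ?_⟩
    induction t using Quotient.inductionOn
    induction t' using Quotient.inductionOn
    induction c using Quotient.inductionOn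
    rfl

/-- The relation `a ∼_L b`: `a ≦_L b` and `b ≦_L a`. -/
def HomotopySet.EquivL (a b : HomotopySet X Y) : Prop := AntisymmRel HomotopySet.leL a b

/-- The set `[X, Y]_L = [X, Y] / ∼_L`. -/
def HomotopySetL (X : Type u) [TopologicalSpace X] (Y : Type v) [TopologicalSpace Y] :
    Type (max u v) :=
  Antisymmetrization (HomotopySet X Y) HomotopySet.leL

/-- The projection `π_L : [X, Y] → [X, Y]_L`. -/
def HomotopySet.toL (a : HomotopySet X Y) : HomotopySetL X Y :=
  toAntisymmetrization HomotopySet.leL a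

/-- The dual Gottlieb set `G^n(X, f, Y) ⊆ H^n(X; ℤ)`, with free maps and free homotopies: the
classes represented by a map `a : X → K(ℤ, n)` for which `(f × a) ∘ Δ : X → Y × K(ℤ, n)`
factors up to homotopy through `Y ∨ K(ℤ, n)`. -/
def gottliebSet {K : Type w} [TopologicalSpace K] {n : ℕ} (ι : Cohomology n K)
    (y₀ : Y) (k₀ : K) (f : C(X, Y)) : Set (Cohomology n X) :=
  {α | ∃ a : C(X, K), Cohomology.pullback n a ι = α ∧
    ∃ φ : C(X, Wedge y₀ k₀), ((Wedge.incl y₀ k₀).comp φ).Homotopic (f.prodMk a)}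

end Free

/-! ### The based homotopy set and based dual Gottlieb sets -/

/-- Based continuous maps `(X, x₀) → (Y, y₀)`. -/
abbrev BasedMap {X : Type u} [TopologicalSpace X] {Y : Type v} [TopologicalSpace Y]
    (x₀ : X) (y₀ : Y) : Type (max u v) :=
  {f : C(X, Y) // f x₀ = y₀}

section Based

variable {X : Type u} [TopologicalSpace X] {Y : Type v} [TopologicalSpace Y]
  {Z : Type w} [TopologicalSpace Z] {x₀ : X} {y₀ : Y} {z₀ : Z}

/-- Composition of based maps. -/
def BasedMap.comp (g : BasedMap y₀ z₀) (f : BasedMap x₀ y₀) : BasedMap x₀ z₀ :=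
  ⟨g.1.comp f.1, by rw [ContinuousMap.comp_apply, f.2, g.2]⟩

/-- Homotopy through based maps. -/
def BasedMap.Homotopic (f g : BasedMap x₀ y₀) : Prop := f.1.HomotopicRel g.1 {x₀}

theorem BasedMap.Homotopic.equivalence :
    Equivalence (BasedMap.Homotopic : BasedMap x₀ y₀ → BasedMap x₀ y₀ → Prop) :=
  ⟨fun _ => ContinuousMap.HomotopicRel.refl _, fun h => ContinuousMap.HomotopicRel.symm h,
    fun h h' => ContinuousMap.HomotopicRel.trans h h'⟩

theorem BasedMap.Homotopic.comp {g g' : BasedMap y₀ z₀} {f f' : BasedMap x₀ y₀}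
    (hg : g.Homotopic g') (hf : f.Homotopic f') : (g.comp f).Homotopic (g'.comp f') := by
  obtain ⟨G⟩ := hg
  obtain ⟨F⟩ := hf
  refine ⟨⟨G.toHomotopy.comp F.toHomotopy, ?_⟩⟩
  intro t x hx
  have hx' : x = x₀ := hx
  subst hx'
  have h1 : F (t, x) = y₀ := by rw [F.eq_fst t (Set.mem_singleton x), f.2]
  have h2 : G (t, y₀) = z₀ := by rw [G.eq_fst t (Set.mem_singleton y₀), g.2]
  change G (t, F (t, x)) = g.1 (f.1 x)
  rw [h1, h2, f.2, g.2]

/-- The based homotopy set `[(X, x₀), (Y, y₀)]_*`. -/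
def BasedHomotopySet (x₀ : X) (y₀ : Y) : Type (max u v) :=
  Quotient (⟨BasedMap.Homotopic, BasedMap.Homotopic.equivalence⟩ : Setoid (BasedMap x₀ y₀))

/-- The based homotopy class `[f]`. -/
def BasedHomotopySet.mk (f : BasedMap x₀ y₀) : BasedHomotopySet x₀ y₀ := Quotient.mk _ f

/-- The action of `[Y, Y]_*` on `[X, Y]_*`. -/
def BasedHomotopySet.comp (t : BasedHomotopySet y₀ y₀) (a : BasedHomotopySet x₀ y₀) :
    BasedHomotopySet x₀ y₀ :=
  Quotient.map₂ (fun (t : BasedMap y₀ y₀) (f : BasedMap x₀ y₀) => t.comp f)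
    (fun _ _ ht _ _ hf => BasedMap.Homotopic.comp ht hf) t a

/-- The relation `a ≦_L b`: there is `t ∈ [Y, Y]_*` with `a = t ∘ b`. -/
def BasedHomotopySet.leL (a b : BasedHomotopySet x₀ y₀) : Prop :=
  ∃ t : BasedHomotopySet y₀ y₀, a = t.comp b

instance : IsPreorder (BasedHomotopySet x₀ y₀) BasedHomotopySet.leL where
  refl a := by
    refine ⟨BasedHomotopySet.mk ⟨ContinuousMap.id Y, rfl⟩, ?_⟩
    induction a using Quotient.inductionOn
    rfl
  trans a b c := by
    rintro ⟨t, rfl⟩ ⟨t', rfl⟩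
    refine ⟨t.comp t', ?_⟩
    induction t using Quotient.inductionOn
    induction t' using Quotient.inductionOn
    induction c using Quotient.inductionOn
    rfl

/-- The relation `a ∼_L b`: `a ≦_L b` and `b ≦_L a`. -/
def BasedHomotopySet.EquivL (a b : BasedHomotopySet x₀ y₀) : Prop :=
  AntisymmRel BasedHomotopySet.leL a b

/-- The quotient of the based homotopy set by `∼_L`. -/
def BasedHomotopySetL (x₀ : X) (y₀ : Y) : Type (max u v) :=
  Antisymmetrization (BasedHomotopySet x₀ y₀) BasedHomotopySet.leL

/-- The projection `π_L`. -/
def BasedHomotopySet.toL (a : BasedHomotopySet x₀ y₀) : BasedHomotopySetL x₀ y₀ :=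
  toAntisymmetrization BasedHomotopySet.leL a

/-- `(f × a) ∘ Δ : X → Y × Z` as a based map. -/
def BasedMap.prodMk (f : BasedMap x₀ y₀) (a : BasedMap x₀ z₀) : BasedMap x₀ (y₀, z₀) :=
  ⟨f.1.prodMk a.1, Prod.ext f.2 a.2⟩

/-- The inclusion `Y ∨ Z → Y × Z` as a based map. -/
def Wedge.basedIncl (y₀ : Y) (z₀ : Z) : BasedMap (Wedge.base y₀ z₀) (y₀, z₀) :=
  ⟨Wedge.incl y₀ z₀, rfl⟩

/-- The dual Gottlieb set `G^n(X, f, Y) ⊆ H^n(X; ℤ)`, with based maps and based homotopies. -/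
def basedGottliebSet {K : Type w} [TopologicalSpace K] {n : ℕ} (ι : Cohomology n K) (k₀ : K)
    (f : BasedMap x₀ y₀) : Set (Cohomology n X) :=
  {α | ∃ a : BasedMap x₀ k₀, Cohomology.pullback n a.1 ι = α ∧
    ∃ φ : BasedMap x₀ (Wedge.base y₀ k₀), ((Wedge.basedIncl y₀ k₀).comp φ).Homotopic (f.prodMk a)}

end Based

end DualGottlieb

end

namespace DualGottlieb

universe u v w

section Wedge

variable {Y : Type u} [TopologicalSpace Y] {K : Type v} [TopologicalSpace K] {y₀ : Y} {k₀ : K}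

/-! A based self-map `s` of `Y` acts compatibly on wedge and product: `j ∘ (s ∨ id) = (s × id) ∘ j`.
Hence if `j ∘ φ` is homotopic to `(f, a)`, then `(s ∨ id) ∘ φ` lifts `(s ∘ f, a)` up to homotopy,
with the same `a` and so the same cohomology class. This gives the inclusion of Gottlieb sets
(`basedGottliebSet_subset`, `gottliebSet_subset_of_based`). A free `s` may move `y₀` and then
induces no map of the wedge; `WellPointed.exists_based_homotopic` first deforms it to a based map.
Two opposite inclusions give invariance under `∼_L`, and both maps on homotopy sets descend from
that. -/

/-- The self-map `s ∨ id` of `Y ∨ K` induced by a based self-map `s` of `Y`. -/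
def Wedge.mapLeft (k₀ : K) (s : BasedMap y₀ y₀) :
    BasedMap (Wedge.base y₀ k₀) (Wedge.base y₀ k₀) :=
  ⟨⟨fun p => ⟨(s.1 p.1.1, p.1.2), p.2.imp (fun h => by rw [h, s.2]) id⟩, by fun_prop⟩,
    Subtype.ext (Prod.ext s.2 rfl)⟩

end Wedge

/-! ### Free maps and free homotopies -/

section Free

variable {X : Type u} [TopologicalSpace X] {Y : Type v} [TopologicalSpace Y]
  {K : Type w} [TopologicalSpace K] {n : ℕ}

/-- In a path-connected well-pointed space every self-map is freely homotopic to a based one. -/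
theorem WellPointed.exists_based_homotopic [PathConnectedSpace Y] {y₀ : Y}
    (hY : WellPointed y₀) (s : C(Y, Y)) : ∃ t : BasedMap y₀ y₀, s.Homotopic t.1 := by
  -- The homotopy extension property drags `s` along a path from `s y₀` to `y₀`; the end of the
  -- resulting homotopy is based.
  obtain ⟨γ⟩ := PathConnectedSpace.joined (s y₀) y₀
  obtain ⟨H, h₀, h₁⟩ := hY Y s γ.toContinuousMap γ.source
  refine ⟨⟨H.comp ((ContinuousMap.const Y 1).prodMk (ContinuousMap.id Y)),
    (h₁ 1).trans γ.target⟩, ⟨⟨H, h₀, fun _ => rfl⟩⟩⟩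

theorem gottliebSet_subset_of_based (ι : Cohomology n K) {y₀ : Y} (k₀ : K) {f g : C(X, Y)}
    (s : BasedMap y₀ y₀) (h : g.Homotopic (s.1.comp f)) :
    gottliebSet ι y₀ k₀ f ⊆ gottliebSet ι y₀ k₀ g := by
  rintro α ⟨a, ha, φ, hφ⟩
  refine ⟨a, ha, (Wedge.mapLeft k₀ s).1.comp φ, ?_⟩
  -- Both `j ∘ (s ∨ id) = (s × id) ∘ j` and `(s × id) ∘ (f, a) = (s ∘ f, a)` hold definitionally, so
  -- the homotopies concatenate without rewriting.
  exact ((ContinuousMap.Homotopic.refl (s.1.prodMap (ContinuousMap.id K))).comp hφ).trans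
    (h.symm.prodMk (.refl a))

theorem gottliebSet_subset [PathConnectedSpace Y] (ι : Cohomology n K) {y₀ : Y}
    (hY : WellPointed y₀) (k₀ : K) {f g : C(X, Y)} (s : C(Y, Y)) (h : g.Homotopic (s.comp f)) :
    gottliebSet ι y₀ k₀ f ⊆ gottliebSet ι y₀ k₀ g := by
  obtain ⟨t, ht⟩ := hY.exists_based_homotopic s
  exact gottliebSet_subset_of_based ι k₀ t (h.trans (ht.comp (.refl f)))

theorem HomotopySet.mk_leL_mk {f g : C(X, Y)} :
    (mk g).leL (mk f) ↔ ∃ s : C(Y, Y), g.Homotopic (s.comp f) := by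
  constructor
  · rintro ⟨t, ht⟩
    induction t using Quotient.inductionOn with
    | h s => exact ⟨s, Quotient.exact ht⟩
  · rintro ⟨s, hs⟩
    exact ⟨mk s, Quotient.sound hs⟩

theorem gottliebSet_eq_of_equivL [PathConnectedSpace Y] (ι : Cohomology n K) {y₀ : Y}
    (hY : WellPointed y₀) (k₀ : K) {f g : C(X, Y)}
    (h : (HomotopySet.mk f).EquivL (HomotopySet.mk g)) :
    gottliebSet ι y₀ k₀ f = gottliebSet ι y₀ k₀ g := by
  obtain ⟨s, hs⟩ := HomotopySet.mk_leL_mk.1 h.1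
  obtain ⟨t, ht⟩ := HomotopySet.mk_leL_mk.1 h.2
  -- The assignment reverses order: `[f] ≦_L [g]` puts the set of `g` inside that of `f`.
  exact (gottliebSet_subset ι hY k₀ t ht).antisymm (gottliebSet_subset ι hY k₀ s hs)

end Free

/-! ### Based maps and based homotopies -/

section Based

variable {X : Type u} [TopologicalSpace X] {Y : Type v} [TopologicalSpace Y]
  {K : Type w} [TopologicalSpace K] {n : ℕ} {x₀ : X} {y₀ : Y} {k₀ : K}

theorem BasedMap.Homotopic.prodMk {f g : BasedMap x₀ y₀} {a b : BasedMap x₀ k₀}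
    (hf : f.Homotopic g) (ha : a.Homotopic b) : (f.prodMk a).Homotopic (g.prodMk b) := by
  obtain ⟨F⟩ := hf
  obtain ⟨A⟩ := ha
  exact ⟨⟨F.toHomotopy.prodMk A.toHomotopy,
    fun t x hx => Prod.ext (F.eq_fst t hx) (A.eq_fst t hx)⟩⟩

theorem basedGottliebSet_subset (ι : Cohomology n K) {f g : BasedMap x₀ y₀}
    (s : BasedMap y₀ y₀) (h : g.Homotopic (s.comp f)) :
    basedGottliebSet ι k₀ f ⊆ basedGottliebSet ι k₀ g := by
  rintro α ⟨a, ha, φ, hφ⟩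
  let S : BasedMap (y₀, k₀) (y₀, k₀) :=
    ⟨s.1.prodMap (ContinuousMap.id K), Prod.ext s.2 rfl⟩
  refine ⟨a, ha, (Wedge.mapLeft k₀ s).comp φ, ?_⟩
  have h₁ : (S.comp ((Wedge.basedIncl y₀ k₀).comp φ)).Homotopic (S.comp (f.prodMk a)) :=
    BasedMap.Homotopic.comp (BasedMap.Homotopic.equivalence.refl S) hφ
  have h₂ : ((s.comp f).prodMk a).Homotopic (g.prodMk a) :=
    (BasedMap.Homotopic.equivalence.symm h).prodMk (BasedMap.Homotopic.equivalence.refl a)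
  -- As in the free case, the endpoints of `h₁` and `h₂` match definitionally.
  exact BasedMap.Homotopic.equivalence.trans h₁ h₂

theorem BasedHomotopySet.mk_leL_mk {f g : BasedMap x₀ y₀} :
    (mk g).leL (mk f) ↔ ∃ s : BasedMap y₀ y₀, g.Homotopic (s.comp f) := by
  constructor
  · rintro ⟨t, ht⟩
    induction t using Quotient.inductionOn with
    | h s => exact ⟨s, Quotient.exact ht⟩
  · rintro ⟨s, hs⟩
    exact ⟨mk s, Quotient.sound hs⟩

theorem basedGottliebSet_eq_of_equivL (ι : Cohomology n K) {f g : BasedMap x₀ y₀}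
    (h : (BasedHomotopySet.mk f).EquivL (BasedHomotopySet.mk g)) :
    basedGottliebSet ι k₀ f = basedGottliebSet ι k₀ g := by
  obtain ⟨s, hs⟩ := BasedHomotopySet.mk_leL_mk.1 h.1
  obtain ⟨t, ht⟩ := BasedHomotopySet.mk_leL_mk.1 h.2
  exact (basedGottliebSet_subset ι t ht).antisymm (basedGottliebSet_subset ι s hs)

end Based

end DualGottlieb

theorem mainTheorem7
    {X : Type*} [TopologicalSpace X] {Y : Type*} [TopologicalSpace Y]
    {K : Type*} [TopologicalSpace K] (x₀ : X) (y₀ : Y) (k₀ : K)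
    (n : ℕ) [NeZero n] (_hK : DualGottlieb.IsEilenbergMacLane n K k₀)
    (ι : DualGottlieb.Cohomology n K) (_hι : DualGottlieb.IsFundamentalClass ι) :
    -- based maps and based homotopies, arbitrary pointed spaces
    ((∀ f g : DualGottlieb.BasedMap x₀ y₀,
        (∃ s : DualGottlieb.BasedMap y₀ y₀, g.Homotopic (s.comp f)) →
          DualGottlieb.basedGottliebSet ι k₀ f ⊆ DualGottlieb.basedGottliebSet ι k₀ g) ∧
      (∀ f g : DualGottlieb.BasedMap x₀ y₀,
        (DualGottlieb.BasedHomotopySet.mk f).EquivL (DualGottlieb.BasedHomotopySet.mk g) →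
          DualGottlieb.basedGottliebSet ι k₀ f = DualGottlieb.basedGottliebSet ι k₀ g) ∧
      (∃ (𝔤 : DualGottlieb.BasedHomotopySet x₀ y₀ → Set (DualGottlieb.Cohomology n X))
          (𝔤L : DualGottlieb.BasedHomotopySetL x₀ y₀ → Set (DualGottlieb.Cohomology n X)),
        (∀ f : DualGottlieb.BasedMap x₀ y₀,
          𝔤 (DualGottlieb.BasedHomotopySet.mk f) = DualGottlieb.basedGottliebSet ι k₀ f) ∧
        𝔤L ∘ DualGottlieb.BasedHomotopySet.toL = 𝔤)) ∧
    -- free maps and free homotopies, path connected well-pointed target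
    (PathConnectedSpace Y → DualGottlieb.WellPointed y₀ →
      (∀ f g : C(X, Y), (∃ s : C(Y, Y), g.Homotopic (s.comp f)) →
          DualGottlieb.gottliebSet ι y₀ k₀ f ⊆ DualGottlieb.gottliebSet ι y₀ k₀ g) ∧
      (∀ f g : C(X, Y),
        (DualGottlieb.HomotopySet.mk f).EquivL (DualGottlieb.HomotopySet.mk g) →
          DualGottlieb.gottliebSet ι y₀ k₀ f = DualGottlieb.gottliebSet ι y₀ k₀ g) ∧
      (∃ (𝔤 : DualGottlieb.HomotopySet X Y → Set (DualGottlieb.Cohomology n X))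
          (𝔤L : DualGottlieb.HomotopySetL X Y → Set (DualGottlieb.Cohomology n X)),
        (∀ f : C(X, Y),
          𝔤 (DualGottlieb.HomotopySet.mk f) = DualGottlieb.gottliebSet ι y₀ k₀ f) ∧
        𝔤L ∘ DualGottlieb.HomotopySet.toL = 𝔤)) := by
  open DualGottlieb in
  refine ⟨⟨fun f g ⟨s, hs⟩ => basedGottliebSet_subset ι s hs,
    fun f g => basedGottliebSet_eq_of_equivL ι, ?_⟩, fun _ hY =>
    ⟨fun f g ⟨s, hs⟩ => gottliebSet_subset ι hY k₀ s hs,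
    fun f g => gottliebSet_eq_of_equivL ι hY k₀, ?_⟩⟩
  -- Homotopic maps have equal classes, hence `∼_L`-equivalent ones, so `∼_L`-invariance already
  -- contains homotopy invariance. Lifting `𝔤` once more makes the factorization through `π_L` hold
  -- by `rfl`.
  · let 𝔤 : BasedHomotopySet x₀ y₀ → Set (Cohomology n X) :=
      Quotient.lift (basedGottliebSet ι k₀) fun f g h =>
        basedGottliebSet_eq_of_equivL ι (AntisymmRel.of_eq (Quotient.sound h))
    refine ⟨𝔤, Quotient.lift 𝔤 fun a b => ?_, fun _ => rfl, rfl⟩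
    induction a, b using Quotient.inductionOn₂ with
    | h f g => exact basedGottliebSet_eq_of_equivL ι
  · let 𝔤 : HomotopySet X Y → Set (Cohomology n X) :=
      Quotient.lift (gottliebSet ι y₀ k₀) fun f g h =>
        gottliebSet_eq_of_equivL ι hY k₀ (AntisymmRel.of_eq (Quotient.sound h))
    refine ⟨𝔤, Quotient.lift 𝔤 fun a b => ?_, fun _ => rfl, rfl⟩
    induction a, b using Quotient.inductionOn₂ with
    | h f g => exact gottliebSet_eq_of_equivL ι hY k₀
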